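/- Let $G$ be a (discrete) group and let $1\le p<\infty$. Let $CV_p(G)$ be the algebra of $p$-convolution operators, that is, the algebra of all bounded linear operators $T$ on the complex Banach space $\ell^p(G)$ with $T\rho_p(t)=\rho_p(t)T$ for all $t\in G$, where $(\rho_p(t)\xi)(s)=\xi(st)$. Equip $CV_p(G)$ with its weak*-topology: for $1<p<\infty$ and $p'=p/(p-1)$, this is the coarsest topology making continuous all functionals $$T\mapsto \sum_{n=1}^\infty \langle y_n, Tx_n\rangle ,\qquad y_n\in\ell^{p'}(G),\ x_n\in \ell^p(G),\ \sum_{n=1}^\infty\|y_n\|\,\|x_n\|<\infty ,$$ where $\langle y,x\rangle=\sum_{g\in G}y(g)x(g)$ (that is, the topology inherited from $\mathcal B(\ell^p(G))=(\ell^{p'}(G)\,\widehat\otimes\,\ell^p(G))^*$); for $p=1$, it is the weak*-topology of $\ell^1(G)=c_0(G)^*$ under the identification $CV_1(G)\cong\ell^1(G)$, $T\mapsto T\delta_e$. Then $CV_p(G)$ is weak*-simple, meaning that its only weak*-closed two-sided ideals are $\{0\}$ and $CV_p(G)$, if and only if $G$ is an ICC group, meaning that the conjugacy class of every $g\in G\setminus\{e\}$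 is infinite. -/

import Mathlib

open scoped ENNReal Topology

/-- A group is ICC if every conjugacy class other than that of the identity is infinite. -/
def IsICC (G : Type*) [Group G] : Prop :=
  ∀ g : G, g ≠ 1 → (conjugatesOf g).Infinite

/-- The complex Banach space `ℓ^p(G)`. -/
abbrev EllP (p : ℝ≥0∞) (G : Type*) : Type _ := lp (fun _ : G => ℂ) p

/-- Membership in `ℓ^p` is invariant under permutations of the index set. -/
theorem memℓp_comp_equiv {ι : Type*} {p : ℝ≥0∞} {f : ι → ℂ} (hf : Memℓp f p) (e : ι ≃ ι) :
    Memℓp (fun i => f (e i)) p := by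
  rcases p.trichotomy with (rfl | rfl | hp)
  · rw [memℓp_zero_iff] at hf ⊢
    exact hf.preimage (e.injective.injOn)
  · rw [memℓp_infty_iff] at hf ⊢
    refine hf.mono ?_
    rintro _ ⟨i, rfl⟩
    exact ⟨e i, rfl⟩
  · rw [memℓp_gen_iff hp] at hf ⊢
    exact (e.summable_iff (f := fun i => ‖f i‖ ^ p.toReal)).2 hf

/-- The `ℓ^p` norm is invariant under permutations of the index set. -/
theorem norm_comp_equiv {ι : Type*} {p : ℝ≥0∞} (f : lp (fun _ : ι => ℂ) p) (e : ι ≃ ι) :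
    ‖(⟨fun i => f (e i), memℓp_comp_equiv (lp.memℓp f) e⟩ : lp (fun _ : ι => ℂ) p)‖ = ‖f‖ := by
  rcases p.trichotomy with (rfl | rfl | hp)
  · rw [lp.norm_eq_card_dsupport, lp.norm_eq_card_dsupport]
    norm_cast
    refine Finset.card_bij (fun i _ => e i) ?_ ?_ ?_
    · intro i hi
      simpa using hi
    · intro i _ j _ h
      exact e.injective h
    · intro j hj
      exact ⟨e.symm j, by simpa using hj, by simp⟩
  · rw [lp.norm_eq_ciSup, lp.norm_eq_ciSup]
    exact e.iSup_comp (g := fun i => ‖f i‖)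
  · rw [lp.norm_eq_tsum_rpow hp, lp.norm_eq_tsum_rpow hp]
    congr 1
    exact e.tsum_eq (fun i => ‖f i‖ ^ p.toReal)

/-- The right regular representation of `G` on `ℓ^p(G)`: `(ρ_p(t) ξ)(s) = ξ(s t)`. -/
noncomputable def rightRegular (p : ℝ≥0∞) [Fact (1 ≤ p)] {G : Type*} [Group G] (t : G) :
    EllP p G →L[ℂ] EllP p G :=
  LinearMap.mkContinuous
    { toFun := fun ξ => ⟨fun s => ξ (s * t), memℓp_comp_equiv (lp.memℓp ξ) (Equiv.mulRight t)⟩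
      map_add' := fun _ _ => rfl
      map_smul' := fun _ _ => rfl }
    1 (fun ξ => by
      rw [one_mul]
      exact (norm_comp_equiv ξ (Equiv.mulRight t)).le)

/-- The algebra `CV_p(G)` of `p`-convolution operators: the bounded operators on `ℓ^p(G)` that
commute with every right translation `ρ_p(t)`. -/
noncomputable def CV (p : ℝ≥0∞) [Fact (1 ≤ p)] (G : Type*) [Group G] :
    Subalgebra ℂ (EllP p G →L[ℂ] EllP p G) :=
  Subalgebra.centralizer ℂ (Set.range (rightRegular p : G → EllP p G →L[ℂ] EllP p G))

open Classical in
/-- The point mass `δ_e` at the identity of `G`, as an element of `ℓ^p(G)`. -/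
noncomputable def deltaOne (p : ℝ≥0∞) (G : Type*) [Group G] : EllP p G :=
  lp.single p (1 : G) (1 : ℂ)

/-- The functionals on `CV_p(G)` that come from its predual.

* For `p = 1`, the map `T ↦ T δ_e` identifies `CV_1(G)` with `ℓ^1(G)`, whose predual is `c_0(G)`:
  the functionals are `T ↦ ∑_g f(g) (T δ_e)(g)` with `f ∈ c_0(G)`.
* For `1 < p < ∞`, with `p'` the conjugate exponent, the predual of the algebra of bounded operators
  on `ℓ^p(G)` is the projective tensor product of `ℓ^{p'}(G)` and `ℓ^p(G)`; the functionals are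
  `T ↦ ∑_n ⟨y_n, T x_n⟩` with `∑_n ‖y_n‖ ‖x_n‖ < ∞`, restricted to `CV_p(G)`. Here
  `⟨y, x⟩ = ∑_g y(g) x(g)`. -/
def cvPredual (p : ℝ≥0∞) [Fact (1 ≤ p)] (G : Type*) [Group G] : Set (CV p G → ℂ) :=
  {φ | (p = 1 ∧ ∃ f : G → ℂ, Filter.Tendsto f Filter.cofinite (𝓝 0) ∧
          ∀ T : CV p G, φ T = ∑' g : G, f g * (T : EllP p G →L[ℂ] EllP p G) (deltaOne p G) g) ∨
       (p ≠ 1 ∧ ∃ (y : ℕ → EllP (ENNReal.conjExponent p) G) (x : ℕ → EllP p G),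
          Summable (fun n => ‖y n‖ * ‖x n‖) ∧
          ∀ T : CV p G,
            φ T = ∑' n : ℕ, ∑' g : G, y n g * (T : EllP p G →L[ℂ] EllP p G) (x n) g)}

/-- The weak*-topology on `CV_p(G)`: the coarsest topology for which all the functionals coming from
the predual are continuous. -/
@[reducible] noncomputable def cvWeakStar (p : ℝ≥0∞) [Fact (1 ≤ p)] (G : Type*) [Group G] : TopologicalSpace (CV p G) :=
  ⨅ φ ∈ cvPredual p G, TopologicalSpace.induced φ inferInstance

/-- An algebra `A` with a (weak*-)topology `τ` is weak*-simple if it has no proper, non-zero,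
`τ`-closed two-sided ideals. -/
def IsWeakStarSimple (A : Type*) [Ring A] (τ : TopologicalSpace A) : Prop :=
  ∀ I : TwoSidedIdeal A, IsClosed[τ] (I : Set A) → I = ⊥ ∨ I = ⊤

/-! An operator `T` in CV_p(G) is determined by the coefficients of `T δ_e`, and on norm-bounded
sets convergence of these coefficients gives weak* convergence (`tendsto_cvWeakStar_of_bounded`).
The conjugate λ(t)Tλ(t)⁻¹ has at a the coefficient of `T` at t⁻¹at. If G is ICC, B. H. Neumann's
lemma on coset covers (`conjFilter_neBot`) lets t move so that t⁻¹at leaves every finite set, for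
all a ≠ e at once; the conjugates then converge to (Tδ_e)(e)·1. A nonzero closed ideal contains,
after a left translation, some `T` with (Tδ_e)(e) ≠ 0, hence contains 1.

Conversely, if q ≠ 0 commutes with CV_p(G), then {T | Tq = 0} is a weak*-closed ideal without 1, so
a nonzero a in CV_p(G) with aq = 0 refutes simplicity. Schur's theorem reduces the non-ICC case to
two situations (`exists_of_not_isICC`). For a finite normal subgroup N ≠ 1, take a = ∑ ρ(m) over N
and q = ρ(n) - 1. For g of infinite order with finitely many commuting conjugates, zero divisors
come from (|cos| + cos)(|cos| - cos) = 0: since √(1 - x) has an absolutely convergent power series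
on the closed unit ball, |cos| = √(1 - sin²) can be applied to each isometry ρ(h). Then a is the
product of |cos| + cos over all conjugates of g, and q is |cos| - cos at ρ(g). Both are shown
nonzero on ℓ^1, where every bounded function on G is a functional. -/

open Filter
open scoped commutatorElement

/-! ### Point masses and coefficients -/

section Delta

open Classical in
/-- The point mass at `g`, as an element of `ℓ^p(G)`. -/
noncomputable def pointMass (p : ℝ≥0∞) {G : Type*} (g : G) : EllP p G :=
  lp.single p g (1 : ℂ)

variable {p : ℝ≥0∞} {G : Type*}

open Classical in
theorem pointMass_apply (g h : G) : pointMass p g h = if h = g then (1 : ℂ) else 0 := by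
  simp [pointMass, lp.single_apply, Pi.single_apply]

theorem pointMass_self (g : G) : pointMass p g g = 1 := by
  simp [pointMass_apply]

theorem deltaOne_eq_pointMass [Group G] : deltaOne p G = pointMass p 1 := by
  rfl

theorem hasSum_smul_pointMass [Fact (1 ≤ p)] (hp : p ≠ ∞) (x : EllP p G) :
    HasSum (fun g => x g • pointMass p g) x := by
  classical
  convert lp.hasSum_single hp x using 2 with g
  ext h
  by_cases hg : h = g
  · subst hg; simp [pointMass_apply]
  · simp [pointMass_apply, hg]

theorem topologicalClosure_span_pointMass [Fact (1 ≤ p)] (hp : p ≠ ∞) :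
    (Submodule.span ℂ (Set.range (pointMass p : G → EllP p G))).topologicalClosure = ⊤ := by
  refine eq_top_iff.2 fun x _ => ?_
  refine mem_closure_of_tendsto (hasSum_smul_pointMass hp x) (Eventually.of_forall fun s => ?_)
  exact Submodule.sum_mem _ fun g _ => Submodule.smul_mem _ _ (Submodule.subset_span ⟨g, rfl⟩)

theorem rightRegular_apply [Fact (1 ≤ p)] [Group G] (t : G) (x : EllP p G) (s : G) :
    rightRegular p t x s = x (s * t) := rfl

open Classical in
theorem rightRegular_pointMass [Fact (1 ≤ p)] [Group G] (t g : G) :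
    rightRegular p t (pointMass p g) = pointMass p (g * t⁻¹) := by
  ext s
  rw [rightRegular_apply, pointMass_apply, pointMass_apply]
  exact if_congr eq_mul_inv_iff_mul_eq.symm rfl rfl

theorem mem_CV_iff [Fact (1 ≤ p)] [Group G] (T : EllP p G →L[ℂ] EllP p G) :
    T ∈ CV p G ↔ ∀ t, rightRegular p t * T = T * rightRegular p t := by
  simp [CV, Subalgebra.mem_centralizer_iff]

theorem CV_apply_rightRegular [Fact (1 ≤ p)] [Group G] (T : CV p G) (t : G) (x : EllP p G) :
    (T : EllP p G →L[ℂ] EllP p G) (rightRegular p t x) =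
      rightRegular p t ((T : EllP p G →L[ℂ] EllP p G) x) :=
  (congrArg (fun S : EllP p G →L[ℂ] EllP p G => S x) ((mem_CV_iff _).1 T.2 t)).symm

theorem CV_apply_pointMass [Fact (1 ≤ p)] [Group G] (T : CV p G) (h g : G) :
    (T : EllP p G →L[ℂ] EllP p G) (pointMass p h) g =
      (T : EllP p G →L[ℂ] EllP p G) (deltaOne p G) (g * h⁻¹) := by
  rw [deltaOne_eq_pointMass, ← rightRegular_apply h⁻¹, ← CV_apply_rightRegular,
    rightRegular_pointMass]
  simp

/-- Two bounded operators on `ℓ^p` that agree on point masses are equal. -/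
theorem clm_ext_pointMass [Fact (1 ≤ p)] (hp : p ≠ ∞) {F : Type*} [NormedAddCommGroup F]
    [NormedSpace ℂ F] {S T : EllP p G →L[ℂ] F}
    (h : ∀ g, S (pointMass p g) = T (pointMass p g)) : S = T := by
  refine ContinuousLinearMap.ext_on (s := Set.range (pointMass p)) ?_ ?_
  · exact Submodule.dense_iff_topologicalClosure_eq_top.2 (topologicalClosure_span_pointMass hp)
  · rintro _ ⟨g, rfl⟩
    exact h g

theorem CV_ext [Fact (1 ≤ p)] [Group G] (hp : p ≠ ∞) {S T : CV p G}
    (h : (S : EllP p G →L[ℂ] EllP p G) (deltaOne p G) =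
      (T : EllP p G →L[ℂ] EllP p G) (deltaOne p G)) : S = T := by
  refine Subtype.ext (clm_ext_pointMass hp fun g => ?_)
  ext s
  rw [CV_apply_pointMass, CV_apply_pointMass, h]

/-- Evaluation at `g`, as a bounded functional on `ℓ^p`. -/
noncomputable def evalCLM (p : ℝ≥0∞) [Fact (1 ≤ p)] {G : Type*} (g : G) : EllP p G →L[ℂ] ℂ :=
  LinearMap.mkContinuous
    { toFun := fun x => x g
      map_add' := fun _ _ => rfl
      map_smul' := fun _ _ => rfl }
    1 (fun x => by
      rw [one_mul]
      exact lp.norm_apply_le_norm (zero_lt_one.trans_le Fact.out).ne' x g)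

theorem evalCLM_apply [Fact (1 ≤ p)] (g : G) (x : EllP p G) : evalCLM p g x = x g := rfl

theorem deltaOne_apply_ne [Group G] {a : G} (ha : a ≠ 1) : deltaOne p G a = 0 := by
  classical
  rw [deltaOne_eq_pointMass, pointMass_apply, if_neg ha]

theorem deltaOne_apply_one [Group G] : deltaOne p G 1 = 1 := by
  rw [deltaOne_eq_pointMass, pointMass_self]

theorem tendsto_zero_cofinite [Fact (1 ≤ p)] (hp : p ≠ ∞) (x : EllP p G) : Tendsto x cofinite (𝓝 0) := by
  have hp0 : 0 < p.toReal := ENNReal.toReal_pos (zero_lt_one.trans_le Fact.out).ne' hp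
  have h := ((lp.memℓp x).summable hp0).tendsto_cofinite_zero
  have h2 := h.rpow_const (p := p.toReal⁻¹) (Or.inr (inv_nonneg.2 hp0.le))
  rw [Real.zero_rpow (inv_ne_zero hp0.ne')] at h2
  refine tendsto_zero_iff_norm_tendsto_zero.2 (h2.congr fun g => ?_)
  rw [← Real.rpow_mul (norm_nonneg _), mul_inv_cancel₀ hp0.ne', Real.rpow_one]

end Delta

/-! ### Duality between ℓ^{p'} and ℓ^p -/

section Pairing

instance fact_one_le_conjExponent (p : ℝ≥0∞) [Fact (1 ≤ p)] :
    Fact (1 ≤ ENNReal.conjExponent p) :=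
  ⟨ENNReal.HolderConjugate.one_le (ENNReal.conjExponent p) p⟩

/-- The duality pairing `⟨y, x⟩ = ∑ y(g) x(g)` between `ℓ^{p'}` and `ℓ^p`. -/
noncomputable def ellPairing (p : ℝ≥0∞) [Fact (1 ≤ p)] (G : Type*) :
    EllP (ENNReal.conjExponent p) G →L[ℂ] EllP p G →L[ℂ] ℂ :=
  lp.dualPairing (ENNReal.conjExponent p) p (fun _ : G => ContinuousLinearMap.mul ℂ ℂ) (K := 1)
    (fun _ => (ContinuousLinearMap.opNorm_mul_le ℂ ℂ).trans NNReal.coe_one.ge)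

variable {p : ℝ≥0∞} [Fact (1 ≤ p)] {G : Type*}

theorem ellPairing_apply (y : EllP (ENNReal.conjExponent p) G) (x : EllP p G) :
    ellPairing p G y x = ∑' g, y g * x g := rfl

theorem norm_ellPairing_apply_le (y : EllP (ENNReal.conjExponent p) G) (x : EllP p G) :
    ‖ellPairing p G y x‖ ≤ ‖y‖ * ‖x‖ := by
  have h : ‖ellPairing p G‖ ≤ 1 :=
    (lp.norm_dualPairing (p := ENNReal.conjExponent p) (q := p) (K := 1)
      (fun _ : G => ContinuousLinearMap.mul ℂ ℂ)
      (fun _ => (ContinuousLinearMap.opNorm_mul_le ℂ ℂ).trans NNReal.coe_one.ge)).trans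
      NNReal.coe_one.le
  refine ((ellPairing p G).le_opNorm₂ y x).trans ?_
  nlinarith [mul_nonneg (norm_nonneg y) (norm_nonneg x)]

theorem ellPairing_pointMass (g : G) (x : EllP p G) :
    ellPairing p G (pointMass _ g) x = x g := by
  rw [ellPairing_apply, tsum_eq_single g]
  · simp [pointMass_self]
  · intro h hh
    simp [pointMass_apply, hh]

end Pairing

/-! ### The weak*-topology on CV_p(G) -/

section WeakStar

variable {p : ℝ≥0∞} [Fact (1 ≤ p)] {G : Type*} [Group G]

theorem continuous_of_mem_cvPredual {φ : CV p G → ℂ} (hφ : φ ∈ cvPredual p G) :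
    @Continuous _ _ (cvWeakStar p G) _ φ :=
  continuous_iff_le_induced.2 (iInf₂_le φ hφ)

theorem tendsto_cvWeakStar {ι : Type*} {l : Filter ι} {T : ι → CV p G} {S : CV p G}
    (h : ∀ φ ∈ cvPredual p G, Tendsto (fun i => φ (T i)) l (𝓝 (φ S))) :
    Tendsto T l (@nhds _ (cvWeakStar p G) S) := by
  simp only [nhds_iInf, nhds_induced, tendsto_iInf, tendsto_comap_iff]
  exact h

/-- Makes annihilators weak*-closed. For p = 1, (Tx)(g) = ∑ x(k⁻¹g) (Tδ_e)(k), and k ↦ x(k⁻¹g) is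
summable, hence in c_0; otherwise the functional is the elementary tensor δ_g ⊗ x. -/
theorem coeff_mem_cvPredual (hp : p ≠ ∞) (x : EllP p G) (g : G) :
    (fun T : CV p G => (T : EllP p G →L[ℂ] EllP p G) x g) ∈ cvPredual p G := by
  by_cases h1 : p = 1
  · let e : G ≃ G := ⟨fun k => k⁻¹ * g, fun h => g * h⁻¹, fun k => by group, fun h => by group⟩
    refine Or.inl ⟨h1, fun k => x (e k), ?_, fun T => ?_⟩
    · have hx : Summable fun k => ‖x k‖ := by
        subst h1
        simpa using (lp.memℓp x).summable (by simp)
      exact tendsto_zero_iff_norm_tendsto_zero.2 (e.summable_iff.2 hx).tendsto_cofinite_zero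
    · have hs := (hasSum_smul_pointMass hp x).mapL
        ((evalCLM p g).comp (T : EllP p G →L[ℂ] EllP p G))
      simp only [ContinuousLinearMap.comp_apply, evalCLM_apply, map_smul, smul_eq_mul,
        CV_apply_pointMass] at hs
      refine hs.tsum_eq.symm.trans ?_
      rw [← e.tsum_eq]
      refine tsum_congr fun k => ?_
      have : g * (e k)⁻¹ = k := e.symm_apply_apply k
      rw [this]
  · refine Or.inr ⟨h1, fun n => if n = 0 then pointMass _ g else 0, fun _ => x, ?_, fun T => ?_⟩
    · refine summable_of_ne_finset_zero (s := {0}) fun n hn => ?_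
      simp_all
    · rw [tsum_eq_single 0]
      · rw [← ellPairing_apply]
        simp [ellPairing_pointMass]
      · intro n hn
        simp [hn]

/-- The set of points where a bounded family of operators converges is closed. -/
theorem isClosed_setOf_tendsto_of_bounded {ι E F : Type*} [NormedAddCommGroup E]
    [NormedSpace ℂ E] [NormedAddCommGroup F] [NormedSpace ℂ F] {l : Filter ι} {T : ι → E →L[ℂ] F}
    {S : E →L[ℂ] F} {C : ℝ} (hT : ∀ i, ‖T i‖ ≤ C) :
    IsClosed {x | Tendsto (fun i => T i x) l (𝓝 (S x))} := by
  refine Equicontinuous.isClosed_setOfPred_tendsto (F := fun i x => T i x) ?_ S.continuous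
  refine UniformEquicontinuous.equicontinuous ?_
  refine LipschitzWith.uniformEquicontinuous _ C.toNNReal fun i => ?_
  exact (T i).lipschitz.weaken (NNReal.le_toNNReal_of_coe_le (hT i))

theorem tendsto_of_mem_topologicalClosure_span {ι E F : Type*} [NormedAddCommGroup E]
    [NormedSpace ℂ E] [NormedAddCommGroup F] [NormedSpace ℂ F] {l : Filter ι} {T : ι → E →L[ℂ] F}
    {S : E →L[ℂ] F} {C : ℝ} (hT : ∀ i, ‖T i‖ ≤ C) {s : Set E}
    (h : ∀ x ∈ s, Tendsto (fun i => T i x) l (𝓝 (S x))) {x : E}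
    (hx : x ∈ (Submodule.span ℂ s).topologicalClosure) :
    Tendsto (fun i => T i x) l (𝓝 (S x)) := by
  refine closure_minimal (fun z hz => ?_) (isClosed_setOf_tendsto_of_bounded (S := S) hT) hx
  induction hz using Submodule.span_induction with
  | mem z hz => exact h z hz
  | zero => simpa using tendsto_const_nhds
  | add y z _ _ hy hz => simpa using Tendsto.add hy hz
  | smul c z _ hz => simpa using Tendsto.const_smul hz c

/-- Truncation to the finite set where |y| ≥ ε/2. The exponent is a variable with `q = ∞` because it
is applied to the conjugate exponent of p = 1. -/
theorem mem_topologicalClosure_span_pointMass_of_tendsto {q : ℝ≥0∞} [Fact (1 ≤ q)] (hq : q = ∞)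
    {H : Type*} (y : EllP q H) (hy : Tendsto y cofinite (𝓝 0)) :
    y ∈ (Submodule.span ℂ (Set.range (pointMass q : H → EllP q H))).topologicalClosure := by
  classical
  subst hq
  refine Metric.mem_closure_iff.2 fun ε hε => ?_
  have hfin : {g | ¬ ‖y g‖ < ε / 2}.Finite :=
    (tendsto_zero_iff_norm_tendsto_zero.1 hy).eventually_lt_const (half_pos hε)
  refine ⟨∑ g ∈ hfin.toFinset, y g • pointMass ∞ g,
    Submodule.sum_mem _ fun g _ => Submodule.smul_mem _ _ (Submodule.subset_span ⟨g, rfl⟩), ?_⟩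
  rw [dist_eq_norm]
  refine (lp.norm_le_of_forall_le (half_pos hε).le fun g => ?_).trans_lt (half_lt_self hε)
  rw [lp.coeFn_sub, Pi.sub_apply, lp.coeFn_sum, Finset.sum_apply]
  simp only [lp.coeFn_smul, Pi.smul_apply, pointMass_apply, smul_eq_mul, mul_ite, mul_one,
    mul_zero, Finset.sum_ite_eq, Set.Finite.mem_toFinset, Set.mem_ofPred_eq]
  split_ifs with hg
  · simpa using hg.le
  · simpa using (half_pos hε).le

theorem tendsto_ellPairing {ι H : Type*} {l : Filter ι} {ξ : ι → EllP p H} {x : EllP p H} {C : ℝ}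
    (hξ : ∀ i, ‖ξ i‖ ≤ C) (h : ∀ g, Tendsto (fun i => ξ i g) l (𝓝 (x g)))
    {y : EllP (ENNReal.conjExponent p) H}
    (hy : y ∈ (Submodule.span ℂ (Set.range (pointMass _))).topologicalClosure) :
    Tendsto (fun i => ellPairing p H y (ξ i)) l (𝓝 (ellPairing p H y x)) := by
  refine tendsto_of_mem_topologicalClosure_span (T := fun i => (ellPairing p H).flip (ξ i))
    (S := (ellPairing p H).flip x) (C := C) (fun i => ?_) ?_ hy
  · refine ContinuousLinearMap.opNorm_le_bound _ ((norm_nonneg _).trans (hξ i)) fun z => ?_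
    rw [ContinuousLinearMap.flip_apply, mul_comm]
    exact (norm_ellPairing_apply_le z (ξ i)).trans (by gcongr; exact hξ i)
  · rintro _ ⟨g, rfl⟩
    simpa only [ContinuousLinearMap.flip_apply, ellPairing_pointMass] using h g

/-- On bounded sets, the weak*-topology of `CV_p(G)` is controlled by the coefficients of the
images of `δ_e`. -/
theorem tendsto_cvWeakStar_of_bounded {ι : Type*} (hp : p ≠ ∞) {l : Filter ι} {T : ι → CV p G}
    {S : CV p G} {C : ℝ} (hT : ∀ i, ‖(T i : EllP p G →L[ℂ] EllP p G)‖ ≤ C)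
    (h : ∀ g, Tendsto (fun i => (T i : EllP p G →L[ℂ] EllP p G) (deltaOne p G) g) l
      (𝓝 ((S : EllP p G →L[ℂ] EllP p G) (deltaOne p G) g))) :
    Tendsto T l (@nhds _ (cvWeakStar p G) S) := by
  have hcoeff : ∀ (x : EllP p G) (g : G),
      Tendsto (fun i => (T i : EllP p G →L[ℂ] EllP p G) x g) l
        (𝓝 ((S : EllP p G →L[ℂ] EllP p G) x g)) := by
    intro x g
    -- Commutation with ρ gives the coefficients of `T δ_k` from those of `T δ_e`; boundedness and
    -- density of point masses give all x.
    refine tendsto_of_mem_topologicalClosure_span (C := ‖evalCLM p g‖ * C)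
      (T := fun i => (evalCLM p g).comp (T i : EllP p G →L[ℂ] EllP p G))
      (S := (evalCLM p g).comp (S : EllP p G →L[ℂ] EllP p G)) (s := Set.range (pointMass p))
      (fun i => ?_) ?_ (topologicalClosure_span_pointMass (p := p) (G := G) hp ▸ Submodule.mem_top)
    · exact (ContinuousLinearMap.opNorm_comp_le _ _).trans (by gcongr; exact hT i)
    · rintro _ ⟨k, rfl⟩
      simpa only [ContinuousLinearMap.comp_apply, evalCLM_apply, CV_apply_pointMass]
        using h (g * k⁻¹)
  have hbd : ∀ (x : EllP p G) i, ‖(T i : EllP p G →L[ℂ] EllP p G) x‖ ≤ C * ‖x‖ := fun x i =>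
    (T i : EllP p G →L[ℂ] EllP p G).le_of_opNorm_le (hT i) x
  refine tendsto_cvWeakStar fun φ hφ => ?_
  rcases hφ with ⟨h1, f, hf, hφ⟩ | ⟨h1, y, x, hyx, hφ⟩
  · have hq : ENNReal.conjExponent p = ∞ := by simp [h1, ENNReal.conjExponent]
    have hfm : Memℓp f (ENNReal.conjExponent p) := by
      rw [hq]
      refine memℓp_infty ?_
      exact (tendsto_zero_iff_norm_tendsto_zero.1 hf).bddAbove_range_of_cofinite
    have hφ' : ∀ R : CV p G, φ R = ellPairing p G ⟨f, hfm⟩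
        ((R : EllP p G →L[ℂ] EllP p G) (deltaOne p G)) := hφ
    simp only [hφ']
    exact tendsto_ellPairing (hbd (deltaOne p G)) (hcoeff (deltaOne p G))
      (mem_topologicalClosure_span_pointMass_of_tendsto hq ⟨f, hfm⟩ hf)
  · have hq : ENNReal.conjExponent p ≠ ∞ := by
      have := Fact.out (p := 1 ≤ p)
      simpa [ENNReal.conjExponent, tsub_eq_zero_iff_le] using lt_of_le_of_ne this (Ne.symm h1)
    have hφ' : ∀ R : CV p G, φ R = ∑' n, ellPairing p G (y n)
        ((R : EllP p G →L[ℂ] EllP p G) (x n)) := hφ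
    simp only [hφ']
    refine tendsto_tsum_of_dominated_convergence (hyx.mul_left C) (fun n => ?_)
      (Eventually.of_forall fun i n => ?_)
    · exact tendsto_ellPairing (hbd (x n)) (hcoeff (x n))
        (topologicalClosure_span_pointMass (G := G) hq ▸ Submodule.mem_top)
    · refine (norm_ellPairing_apply_le _ _).trans ?_
      calc ‖y n‖ * _ ≤ ‖y n‖ * (C * ‖x n‖) := by gcongr; exact hbd _ i
        _ = C * (‖y n‖ * ‖x n‖) := by ring

end WeakStar

/-! ### Conjugacy classes, centralizers and coset covers -/

section Centralizer

variable {G : Type*} [Group G]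

theorem conj_eq_conj_iff_mem_centralizer (a g h : G) :
    g * a * g⁻¹ = h * a * h⁻¹ ↔ g⁻¹ * h ∈ Subgroup.centralizer {a} := by
  rw [Subgroup.mem_centralizer_singleton_iff]
  constructor
  · intro e
    calc g⁻¹ * h * a = g⁻¹ * (h * a * h⁻¹) * h := by group
      _ = a * (g⁻¹ * h) := by rw [← e]; group
  · intro e
    calc g * a * g⁻¹ = g * (a * (g⁻¹ * h)) * h⁻¹ := by group
      _ = h * a * h⁻¹ := by rw [← e]; group

theorem mem_conjugatesOf_iff_exists (a b : G) : b ∈ conjugatesOf a ↔ ∃ g, g * a * g⁻¹ = b := by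
  exact isConj_iff

/-- The centralizer of an element has finite index iff its conjugacy class is finite. -/
theorem finiteIndex_centralizer_iff (a : G) :
    (Subgroup.centralizer {a}).FiniteIndex ↔ (conjugatesOf a).Finite := by
  let f : G ⧸ Subgroup.centralizer {a} → conjugatesOf a :=
    Quotient.lift (fun g => ⟨g * a * g⁻¹, (mem_conjugatesOf_iff_exists _ _).2 ⟨g, rfl⟩⟩)
      fun g h e => Subtype.ext
        ((conj_eq_conj_iff_mem_centralizer a g h).2 (QuotientGroup.leftRel_apply.1 e))
  have hf : Function.Bijective f := by
    constructor
    · intro x y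
      induction x using QuotientGroup.induction_on
      induction y using QuotientGroup.induction_on
      intro e
      exact QuotientGroup.eq.2 ((conj_eq_conj_iff_mem_centralizer a _ _).1 (congrArg Subtype.val e))
    · rintro ⟨b, hb⟩
      obtain ⟨g, rfl⟩ := (mem_conjugatesOf_iff_exists _ _).1 hb
      exact ⟨QuotientGroup.mk g, rfl⟩
  rw [Subgroup.finiteIndex_iff_finite_quotient, (Equiv.ofBijective f hf).finite_iff]
  exact Set.finite_coe_iff

/-- The filter of neighbourhoods of infinity for the conjugation action on `G ∖ {e}`: a set is
small when it is covered by finitely many sets `{t | t⁻¹ a t = b}` with `a ≠ 1`. -/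
def conjFilter (G : Type*) [Group G] : Filter G :=
  Filter.comk
    (fun S => ∃ Q : Set (G × G), Q.Finite ∧ (∀ q ∈ Q, q.1 ≠ 1) ∧
      ∀ t ∈ S, ∃ q ∈ Q, t⁻¹ * q.1 * t = q.2)
    (by exact ⟨∅, Set.finite_empty, by simp, by simp⟩)
    (by
      intro S ⟨Q, hQ, h1, h2⟩ R hRS
      exact ⟨Q, hQ, h1, fun x hx => h2 x (hRS hx)⟩)
    (by
      rintro S ⟨Q, hQ, h1, h2⟩ S' ⟨R, hR, h3, h4⟩
      refine ⟨Q ∪ R, hQ.union hR, fun q hq => hq.elim (h1 q) (h3 q), fun x hx => ?_⟩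
      rcases hx with hx | hx
      · exact (h2 x hx).imp fun _ h => And.imp_left Or.inl h
      · exact (h4 x hx).imp fun _ h => And.imp_left Or.inr h)

theorem tendsto_conj_conjFilter {a : G} (ha : a ≠ 1) :
    Tendsto (fun t => t⁻¹ * a * t) (conjFilter G) cofinite := by
  intro S hS
  rw [mem_map, conjFilter, Filter.mem_comk]
  refine ⟨(fun b => (a, b)) '' Sᶜ, (mem_cofinite.1 hS).image _, ?_, ?_⟩
  · rintro _ ⟨b, -, rfl⟩
    exact ha
  · intro t ht
    exact ⟨(a, t⁻¹ * a * t), ⟨_, ht, rfl⟩, rfl⟩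

open Pointwise in
-- A nonempty set {t | t⁻¹at = b} is a left coset of the centralizer of b. If finitely many covered
-- G, Neumann's lemma would give one of these centralizers finite index, so a nontrivial finite
-- class.
theorem conjFilter_neBot (hG : IsICC G) : (conjFilter G).NeBot := by
  classical
  refine neBot_iff.2 fun hbot => ?_
  have hmem : (∅ : Set G) ∈ conjFilter G := by rw [hbot]; exact mem_bot
  obtain ⟨Q, hQ, h1, h2⟩ := Filter.mem_comk.1 hmem
  let g : G × G → G := fun q =>
    if h : ∃ t : G, t⁻¹ * q.1 * t = q.2 then h.choose else 1
  -- The centralizer is not taken at `q.2`: for a pair with no solution t (where `g q = 1`) it is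
  -- still that of a conjugate of `q.1 ≠ 1`, so the final contradiction applies to every pair.
  let H : G × G → Subgroup G := fun q => Subgroup.centralizer {(g q)⁻¹ * q.1 * g q}
  have hcov : ⋃ q ∈ hQ.toFinset, g q • (H q : Set G) = Set.univ := by
    refine Set.eq_univ_of_forall fun t => ?_
    obtain ⟨q, hq, hqt⟩ := h2 t (by simp)
    refine Set.mem_iUnion₂.2 ⟨q, hQ.mem_toFinset.2 hq, ?_⟩
    have hex : ∃ t : G, t⁻¹ * q.1 * t = q.2 := ⟨t, hqt⟩
    have hg : (g q)⁻¹ * q.1 * g q = q.2 := by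
      simp only [g, dif_pos hex]
      exact hex.choose_spec
    rw [mem_leftCoset_iff]
    change _ ∈ Subgroup.centralizer _
    rw [Subgroup.mem_centralizer_singleton_iff]
    calc (g q)⁻¹ * t * ((g q)⁻¹ * q.1 * g q) = (g q)⁻¹ * t * (t⁻¹ * q.1 * t) := by rw [hg, hqt]
      _ = (g q)⁻¹ * q.1 * g q * ((g q)⁻¹ * t) := by group
  obtain ⟨q, hq, hfin⟩ := Subgroup.exists_finiteIndex_of_leftCoset_cover hcov
  refine hG ((g q)⁻¹ * q.1 * g q) (fun h => h1 q (hQ.mem_toFinset.1 hq) ?_)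
    ((finiteIndex_centralizer_iff _).1 hfin)
  calc q.1 = g q * ((g q)⁻¹ * q.1 * g q) * (g q)⁻¹ := by group
    _ = 1 := by rw [h]; group

end Centralizer

/-! ### ICC implies weak*-simple -/

section LeftRegular

variable {p : ℝ≥0∞} [Fact (1 ≤ p)] {G : Type*} [Group G]

/-- The left regular representation of `G` on `ℓ^p(G)`: `(λ_p(t) ξ)(s) = ξ(t⁻¹ s)`. -/
noncomputable def leftRegular (p : ℝ≥0∞) [Fact (1 ≤ p)] {G : Type*} [Group G] (t : G) :
    EllP p G →L[ℂ] EllP p G :=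
  LinearMap.mkContinuous
    { toFun := fun ξ => ⟨fun s => ξ (t⁻¹ * s), memℓp_comp_equiv (lp.memℓp ξ) (Equiv.mulLeft t⁻¹)⟩
      map_add' := fun _ _ => rfl
      map_smul' := fun _ _ => rfl }
    1 (fun ξ => by
      rw [one_mul]
      exact (norm_comp_equiv ξ (Equiv.mulLeft t⁻¹)).le)

theorem leftRegular_apply (t : G) (x : EllP p G) (s : G) : leftRegular p t x s = x (t⁻¹ * s) := rfl

theorem norm_leftRegular_le (t : G) : ‖leftRegular p t‖ ≤ 1 :=
  LinearMap.mkContinuous_norm_le _ zero_le_one _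

theorem leftRegular_mem_CV (t : G) : leftRegular p t ∈ CV p G := by
  rw [mem_CV_iff]
  intro s
  ext x k
  change x (t⁻¹ * (k * s)) = x (t⁻¹ * k * s)
  rw [mul_assoc]

/-- `λ_p(t)` as an element of `CV_p(G)`. -/
noncomputable def leftRegularCV (p : ℝ≥0∞) [Fact (1 ≤ p)] {G : Type*} [Group G] (t : G) : CV p G :=
  ⟨leftRegular p t, leftRegular_mem_CV t⟩

/-- Since λ(t⁻¹)δ_e = δ_{t⁻¹} = ρ(t)δ_e, the right-hand factor can be moved past `T`. -/
theorem conj_leftRegular_coeff (T : CV p G) (t a : G) :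
    ((leftRegularCV p t * T * leftRegularCV p t⁻¹ : CV p G) : EllP p G →L[ℂ] EllP p G)
      (deltaOne p G) a = (T : EllP p G →L[ℂ] EllP p G) (deltaOne p G) (t⁻¹ * a * t) := by
  have h : leftRegular p t⁻¹ (deltaOne p G) = rightRegular p t (deltaOne p G) := by
    classical
    ext s
    rw [leftRegular_apply, rightRegular_apply, deltaOne_eq_pointMass, pointMass_apply,
      pointMass_apply]
    refine if_congr ?_ rfl rfl
    rw [inv_inv, mul_eq_one_iff_eq_inv', mul_eq_one_iff_eq_inv]
  change leftRegular p t ((T : EllP p G →L[ℂ] EllP p G) (leftRegular p t⁻¹ (deltaOne p G))) a = _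
  rw [h, CV_apply_rightRegular, leftRegular_apply, rightRegular_apply]

/-- If `G` is ICC, the conjugates `λ(t) T λ(t)⁻¹` tend to `(T δ_e)(e) • 1` along `conjFilter G`. -/
theorem tendsto_conj_leftRegular (hp : p ≠ ∞) (T : CV p G) :
    Tendsto (fun t => leftRegularCV p t * T * leftRegularCV p t⁻¹) (conjFilter G)
      (@nhds _ (cvWeakStar p G)
        ((T : EllP p G →L[ℂ] EllP p G) (deltaOne p G) 1 • (1 : CV p G))) := by
  refine tendsto_cvWeakStar_of_bounded hp (C := ‖(T : EllP p G →L[ℂ] EllP p G)‖)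
    (fun t => ?_) (fun a => ?_)
  · change ‖leftRegular p t * (T : EllP p G →L[ℂ] EllP p G) * leftRegular p t⁻¹‖ ≤ _
    refine (norm_mul_le _ _).trans ?_
    have h1 := norm_mul_le (leftRegular p t) (T : EllP p G →L[ℂ] EllP p G)
    have h2 := norm_leftRegular_le (p := p) t
    have h3 := norm_leftRegular_le (p := p) t⁻¹
    have h4 : ‖leftRegular p t * (T : EllP p G →L[ℂ] EllP p G)‖ ≤
      ‖(T : EllP p G →L[ℂ] EllP p G)‖ := h1.trans (mul_le_of_le_one_left (norm_nonneg _) h2)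
    exact (mul_le_of_le_one_right (norm_nonneg _) h3).trans h4
  · simp only [conj_leftRegular_coeff]
    change Tendsto _ _ (𝓝 ((T : EllP p G →L[ℂ] EllP p G) (deltaOne p G) 1 * deltaOne p G a))
    by_cases ha : a = 1
    · subst ha
      simpa [deltaOne_apply_one] using tendsto_const_nhds
    · rw [deltaOne_apply_ne ha, mul_zero]
      exact (tendsto_zero_cofinite hp _).comp (tendsto_conj_conjFilter ha)

theorem isWeakStarSimple_of_isICC (hp : p ≠ ∞) (hG : IsICC G) :
    IsWeakStarSimple (CV p G) (cvWeakStar p G) := by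
  intro I hI
  refine or_iff_not_imp_left.2 fun hne => ?_
  obtain ⟨T, hT, hT0⟩ : ∃ T ∈ I, T ≠ 0 := by
    by_contra! h
    exact hne (le_bot_iff.1 fun T hT => (TwoSidedIdeal.mem_bot _).2 (h T hT))
  obtain ⟨g, hg⟩ : ∃ g, (T : EllP p G →L[ℂ] EllP p G) (deltaOne p G) g ≠ 0 := by
    by_contra! h
    refine hT0 (CV_ext hp ?_)
    ext g
    exact h g
  -- Left translation moves the nonzero coefficient at g to the identity.
  set S : CV p G := leftRegularCV p g⁻¹ * T with hS
  have hSI : S ∈ I := I.mul_mem_left _ _ hT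
  have hS1 : (S : EllP p G →L[ℂ] EllP p G) (deltaOne p G) 1 ≠ 0 := by
    change leftRegular p g⁻¹ ((T : EllP p G →L[ℂ] EllP p G) (deltaOne p G)) 1 ≠ 0
    rwa [leftRegular_apply, inv_inv, mul_one]
  have := conjFilter_neBot hG
  have hmem : (S : EllP p G →L[ℂ] EllP p G) (deltaOne p G) 1 • (1 : CV p G) ∈ (I : Set (CV p G)) :=
    @IsClosed.mem_of_tendsto _ (cvWeakStar p G) _ _ _ _ _ this hI (tendsto_conj_leftRegular hp S)
      (Eventually.of_forall fun t => I.mul_mem_right _ _ (I.mul_mem_left _ _ hSI))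
  have h1 : (1 : CV p G) ∈ I := by
    have h := I.mul_mem_left (((S : EllP p G →L[ℂ] EllP p G) (deltaOne p G) 1)⁻¹ • (1 : CV p G)) _
      hmem
    rwa [smul_mul_smul_comm, inv_mul_cancel₀ hS1, one_mul, one_smul] at h
  exact (TwoSidedIdeal.one_mem_iff _).1 h1

end LeftRegular

/-! ### The Catalan series and √(1 - x) -/

section CatalanSeries

/-- The telescoping form bounds the partial sums by 2, giving convergence on the boundary of the
disc, which is needed because sin² is only known to have norm at most 1. -/
theorem catalan_div_four_pow_eq (n : ℕ) :
    (catalan n : ℝ) / 4 ^ n =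
      2 * ((n.centralBinom : ℝ) / 4 ^ n - ((n + 1).centralBinom : ℝ) / 4 ^ (n + 1)) := by
  have h1 : ((n : ℝ) + 1) * catalan n = n.centralBinom := by
    exact_mod_cast succ_mul_catalan_eq_centralBinom n
  have h2 : ((n : ℝ) + 1) * (n + 1).centralBinom = 2 * (2 * n + 1) * n.centralBinom := by
    exact_mod_cast Nat.succ_mul_centralBinom_succ n
  have hn : (n : ℝ) + 1 ≠ 0 := by positivity
  have h3 : ((n + 1).centralBinom : ℝ) = 2 * (2 * n + 1) * catalan n := by
    apply mul_left_cancel₀ hn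
    rw [h2, ← h1]; ring
  rw [h3, ← h1, pow_succ]
  field_simp
  ring

theorem summable_catalan_div_four_pow : Summable fun n => (catalan n : ℝ) / 4 ^ n := by
  refine summable_of_sum_range_le (c := 2) (fun n => by positivity) fun n => ?_
  simp_rw [catalan_div_four_pow_eq, ← Finset.mul_sum]
  rw [Finset.sum_range_sub' (fun n => (n.centralBinom : ℝ) / 4 ^ n)]
  have : (0 : ℝ) ≤ (n.centralBinom : ℝ) / 4 ^ n := by positivity
  simp only [Nat.centralBinom_zero, Nat.cast_one, pow_zero, div_one]
  linarith

/-- The coefficients of the generating function `(1 - √(1 - x)) / (x / 2)`. -/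
noncomputable def catalanCoeff (n : ℕ) : ℂ := ((catalan n : ℝ) / 4 ^ n : ℝ)

theorem norm_catalanCoeff (n : ℕ) : ‖catalanCoeff n‖ = (catalan n : ℝ) / 4 ^ n := by
  rw [catalanCoeff, Complex.norm_real, Real.norm_of_nonneg (by positivity)]

theorem catalanCoeff_zero : catalanCoeff 0 = 1 := by
  simp [catalanCoeff]

theorem sum_antidiagonal_catalanCoeff (n : ℕ) :
    ∑ ij ∈ Finset.HasAntidiagonal.antidiagonal n, catalanCoeff ij.1 * catalanCoeff ij.2 =
      4 * catalanCoeff (n + 1) := by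
  have h : ∀ ij ∈ Finset.HasAntidiagonal.antidiagonal n, catalanCoeff ij.1 * catalanCoeff ij.2 =
      ((catalan ij.1 * catalan ij.2 : ℕ) : ℂ) / 4 ^ n := by
    intro ij hij
    rw [← Finset.HasAntidiagonal.mem_antidiagonal.1 hij, pow_add]
    simp only [catalanCoeff]
    push_cast
    field_simp
  rw [Finset.sum_congr rfl h, ← Finset.sum_div, catalanCoeff, catalan_succ']
  push_cast
  rw [pow_succ]
  field_simp

variable {A : Type*} [NormedRing A] [NormedAlgebra ℂ A]

/-- The sum of the power series `∑ C_n (x / 4) ^ n`, with `C_n` the Catalan numbers. -/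
noncomputable def catalanSum (x : A) : A := ∑' n, catalanCoeff n • x ^ n

variable [NormOneClass A]

theorem summable_norm_catalanSum {x : A} (hx : ‖x‖ ≤ 1) :
    Summable fun n => ‖catalanCoeff n • x ^ n‖ := by
  refine summable_catalan_div_four_pow.of_nonneg_of_le (fun _ => norm_nonneg _) fun n => ?_
  rw [norm_smul, norm_catalanCoeff]
  exact mul_le_of_le_one_right (by positivity) ((norm_pow_le x n).trans
    (pow_le_one₀ (norm_nonneg x) hx))

variable [CompleteSpace A]

theorem hasSum_catalanSum {x : A} (hx : ‖x‖ ≤ 1) :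
    HasSum (fun n => catalanCoeff n • x ^ n) (catalanSum x) :=
  (summable_norm_catalanSum hx).of_norm.hasSum

/-- The Catalan recursion, read through the Cauchy product. This quadratic equation for D makes 1 -
xD/2 a square root of 1 - x. -/
theorem catalanSum_eq {x : A} (hx : ‖x‖ ≤ 1) :
    catalanSum x = 1 + (4⁻¹ : ℂ) • (x * (catalanSum x * catalanSum x)) := by
  have hs := summable_norm_catalanSum hx
  have h2 : catalanSum x * catalanSum x = ∑' n, (4 * catalanCoeff (n + 1)) • x ^ n := by
    rw [catalanSum, tsum_mul_tsum_eq_tsum_sum_antidiagonal_of_summable_norm hs hs]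
    refine tsum_congr fun n => ?_
    rw [← sum_antidiagonal_catalanCoeff, Finset.sum_smul]
    refine Finset.sum_congr rfl fun ij hij => ?_
    rw [smul_mul_smul_comm, ← pow_add, Finset.HasAntidiagonal.mem_antidiagonal.1 hij]
  have hsum : Summable fun n => (4 * catalanCoeff (n + 1)) • x ^ n := by
    have := summable_norm_sum_mul_antidiagonal_of_summable_norm hs hs
    refine (this.of_norm).congr fun n => ?_
    rw [← sum_antidiagonal_catalanCoeff, Finset.sum_smul]
    refine Finset.sum_congr rfl fun ij hij => ?_
    rw [smul_mul_smul_comm, ← pow_add, Finset.HasAntidiagonal.mem_antidiagonal.1 hij]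
  rw [h2, ← hsum.tsum_mul_left, ← tsum_const_smul'' (4⁻¹ : ℂ), catalanSum,
    hs.of_norm.tsum_eq_zero_add]
  congr 1
  · simp [catalanCoeff_zero]
  · refine tsum_congr fun n => ?_
    rw [mul_smul_comm, smul_smul, ← pow_succ']
    congr 1
    ring

end CatalanSeries

/-! ### The zero divisors |cos| ± cos -/

section CosineParts

variable {A : Type*} [NormedRing A] [NormedAlgebra ℂ A]

/-- `sin²`, in terms of `U = e^{iθ}` and `V = e^{-iθ}`. -/
noncomputable def sinSq (U V : A) : A := (4⁻¹ : ℂ) • (2 - U * U - V * V)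

/-- `|cos| + c cos`, in terms of `U = e^{iθ}` and `V = e^{-iθ}`, where `|cos| = √(1 - sin²)`. -/
noncomputable def absCosAdd (c : ℂ) (U V : A) : A :=
  1 - (2⁻¹ : ℂ) • (sinSq U V * catalanSum (sinSq U V)) + (c * 2⁻¹) • (U + V)

theorem sinSq_one_one : sinSq (1 : A) 1 = 0 := by
  rw [sinSq, mul_one, ← one_add_one_eq_two]
  simp

theorem absCosAdd_one_one (c : ℂ) : absCosAdd c (1 : A) 1 = (1 + c) • 1 := by
  rw [absCosAdd, sinSq_one_one, zero_mul, smul_zero, sub_zero, ← two_smul ℂ (1 : A), smul_smul,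
    add_smul, one_smul]
  congr 2
  ring

theorem absCosAdd_neg_one_neg_one (c : ℂ) : absCosAdd c (-1 : A) (-1) = (1 - c) • 1 := by
  have h : sinSq (-1 : A) (-1) = 0 := by
    rw [← sinSq_one_one (A := A)]
    simp [sinSq]
  rw [absCosAdd, h, zero_mul, smul_zero, sub_zero, ← two_smul ℂ (-1 : A), smul_smul,
    sub_smul, one_smul, smul_neg, ← sub_eq_add_neg]
  congr 2
  ring

variable [NormOneClass A]

theorem norm_sinSq_le {U V : A} (hU : ‖U‖ ≤ 1) (hV : ‖V‖ ≤ 1) : ‖sinSq U V‖ ≤ 1 := by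
  have h1 : ‖U * U‖ ≤ 1 := (norm_mul_le _ _).trans (mul_le_one₀ hU (norm_nonneg _) hU)
  have h2 : ‖V * V‖ ≤ 1 := (norm_mul_le _ _).trans (mul_le_one₀ hV (norm_nonneg _) hV)
  have h3 : ‖(2 : A)‖ ≤ 2 := by
    rw [← one_add_one_eq_two]
    refine (norm_add_le _ _).trans ?_
    rw [norm_one]; norm_num
  have h4 := norm_sub_le (2 - U * U) (V * V)
  have h5 := norm_sub_le 2 (U * U)
  rw [sinSq, norm_smul, norm_inv, Complex.norm_ofNat]
  linarith

variable [CompleteSpace A]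

theorem Commute.catalanSum {B x : A} (hx : ‖x‖ ≤ 1) (h : Commute B x) :
    Commute B (catalanSum x) := by
  have hs := hasSum_catalanSum hx
  exact (hs.mul_left B).unique (by
    simpa only [((h.pow_right _).smul_right _).eq] using hs.mul_right B)

/-- `(|cos| + cos)(|cos| - cos) = 0`. -/
theorem absCosAdd_mul_absCosAdd_neg {U V : A} (hU : ‖U‖ ≤ 1) (hV : ‖V‖ ≤ 1) (hUV : U * V = 1)
    (hVU : V * U = 1) : absCosAdd 1 U V * absCosAdd (-1) U V = 0 := by
  have hx := norm_sinSq_le hU hV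
  have hcU : Commute U V := hUV.trans hVU.symm
  have hUVx : Commute (U + V) (sinSq U V) := by
    have h2 : ∀ W : A, Commute W 2 := fun W => Nat.cast_ofNat (R := A) (n := 2) ▸
      (Nat.cast_commute 2 W).symm
    refine Commute.smul_right ?_ _
    refine Commute.add_left ?_ ?_
    · exact ((h2 U).sub_right ((Commute.refl U).mul_right (Commute.refl U))).sub_right
        (hcU.mul_right hcU)
    · exact ((h2 V).sub_right (hcU.symm.mul_right hcU.symm)).sub_right
        ((Commute.refl V).mul_right (Commute.refl V))
  have hxD : Commute (sinSq U V) (catalanSum (sinSq U V)) := (Commute.refl _).catalanSum hx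
  have hD := catalanSum_eq hx
  have hUVD : Commute (U + V) (catalanSum (sinSq U V)) := hUVx.catalanSum hx
  -- (2 cos)² = 4(1 - sin²).
  have hsq : (U + V) * (U + V) = (4 : ℂ) • (1 - sinSq U V) := by
    rw [sinSq, smul_sub, smul_smul, mul_inv_cancel₀ (by norm_num), one_smul, mul_add, add_mul,
      add_mul, hUV, hVU]
    have : (4 : ℂ) • (1 : A) = 1 + 1 + 1 + 1 := by
      rw [show (4 : ℂ) = 1 + 1 + 1 + 1 by norm_num]; simp only [add_smul, one_smul]
    rw [this, ← one_add_one_eq_two]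
    abel
  set x := sinSq U V
  set D := catalanSum x
  set s := 1 - (2⁻¹ : ℂ) • (x * D) with hs
  have hsc : Commute s (U + V) :=
    (((Commute.one_right _).sub_right ((hUVx.mul_right hUVD).smul_right _))).symm
  -- Here s plays |cos|: by the equation for D, (xD)² = 4x(D - 1), so (1 - xD/2)² = 1 - xD + x(D -
  -- 1).
  have hss : s * s = 1 - x := by
    have h3 : x * D * (x * D) = (4 : ℂ) • (x * (D - 1)) := by
      have : D - 1 = (4⁻¹ : ℂ) • (x * (D * D)) := sub_eq_of_eq_add' hD
      rw [this, mul_smul_comm, smul_smul, mul_inv_cancel₀ (by norm_num), one_smul,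
        hxD.symm.mul_mul_mul_comm, mul_assoc]
    rw [hs, mul_sub, sub_mul, sub_mul, smul_mul_smul_comm, h3, smul_smul]
    norm_num
    rw [mul_sub]
    have : x * D = (2⁻¹ : ℂ) • (x * D) + (2⁻¹ : ℂ) • (x * D) := by
      rw [← add_smul]; norm_num
    simp only [one_div]
    rw [mul_one]
    nth_rewrite 3 [this]
    abel
  change (s + (1 * 2⁻¹ : ℂ) • (U + V)) * (s + (-1 * 2⁻¹ : ℂ) • (U + V)) = 0
  rw [add_mul, mul_add, mul_add, smul_mul_smul_comm, hsq, hss, smul_smul, mul_smul_comm,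
    smul_mul_assoc, hsc.eq]
  norm_num

end CosineParts

/-! ### Intertwiners respect the functional calculus -/

section Intertwining

theorem comp_list_prod {ι E F : Type*} [NormedAddCommGroup E]
    [NormedSpace ℂ E] [NormedAddCommGroup F] [NormedSpace ℂ F] {J : E →L[ℂ] F} 
    {f : ι → E →L[ℂ] E} {f' : ι → F →L[ℂ] F}
    (h : ∀ i, J.comp (f i) = (f' i).comp J) (l : List ι) :
    J.comp (l.map f).prod = (l.map f').prod.comp J := by
  induction l with
  | nil => rfl
  | cons i l ih =>
    ext v
    have h1 : ∀ v, J (f i v) = f' i (J v) := fun v => congrArg (fun S : E →L[ℂ] F => S v) (h i)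
    have h2 : ∀ v, J ((l.map f).prod v) = (l.map f').prod (J v) :=
      fun v => congrArg (fun S : E →L[ℂ] F => S v) ih
    simp [h1, h2]

variable {E F : Type*} [NormedAddCommGroup E] [NormedSpace ℂ E] [CompleteSpace E] [Nontrivial E]
  [NormedAddCommGroup F] [NormedSpace ℂ F] [CompleteSpace F] [Nontrivial F]

theorem comp_catalanSum {J : E →L[ℂ] F} {x : E →L[ℂ] E} {y : F →L[ℂ] F} (hx : ‖x‖ ≤ 1)
    (hy : ‖y‖ ≤ 1) (h : J.comp x = y.comp J) :
    J.comp (catalanSum x) = (catalanSum y).comp J := by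
  have hpow : ∀ n, J.comp (x ^ n) = (y ^ n).comp J := by
    intro n
    induction n with
    | zero => rfl
    | succ n ih =>
      ext v
      have h1 := fun v => congrArg (fun S : E →L[ℂ] F => S v) h
      have h2 := fun v => congrArg (fun S : E →L[ℂ] F => S v) ih
      simp only [ContinuousLinearMap.comp_apply] at h1 h2 ⊢
      rw [pow_succ, pow_succ, mul_apply_eq_comp, mul_apply_eq_comp, h2, h1]
  have h1 := (hasSum_catalanSum hx).mapL (ContinuousLinearMap.compL ℂ E E F J)
  have h2 := (hasSum_catalanSum hy).mapL ((ContinuousLinearMap.compL ℂ E F F).flip J)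
  simp only [ContinuousLinearMap.compL_apply, ContinuousLinearMap.flip_apply] at h1 h2
  refine h1.unique (h2.congr_fun fun n => ?_)
  rw [ContinuousLinearMap.comp_smul, ContinuousLinearMap.smul_comp, hpow]

theorem comp_absCosAdd (c : ℂ) {J : E →L[ℂ] F} {U V : E →L[ℂ] E} {U' V' : F →L[ℂ] F}
    (hU : ‖U‖ ≤ 1) (hV : ‖V‖ ≤ 1) (hU' : ‖U'‖ ≤ 1) (hV' : ‖V'‖ ≤ 1)
    (hJU : J.comp U = U'.comp J) (hJV : J.comp V = V'.comp J) :
    J.comp (absCosAdd c U V) = (absCosAdd c U' V').comp J := by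
  have h1 : ∀ v, J (U v) = U' (J v) := fun v => congrArg (fun S : E →L[ℂ] F => S v) hJU
  have h2 : ∀ v, J (V v) = V' (J v) := fun v => congrArg (fun S : E →L[ℂ] F => S v) hJV
  have hx : J.comp (sinSq U V) = (sinSq U' V').comp J := by
    ext v
    simp [sinSq, h1, h2, ← one_add_one_eq_two]
  have hD := comp_catalanSum (norm_sinSq_le hU hV) (norm_sinSq_le hU' hV') hx
  have h3 : ∀ v, J (sinSq U V v) = sinSq U' V' (J v) :=
    fun v => congrArg (fun S : E →L[ℂ] F => S v) hx
  have h4 : ∀ v, J (catalanSum (sinSq U V) v) = catalanSum (sinSq U' V') (J v) :=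
    fun v => congrArg (fun S : E →L[ℂ] F => S v) hD
  ext v
  simp [absCosAdd, h1, h2, h3, h4]

end Intertwining

/-! ### Structure of groups that are not ICC -/

section FiniteClass

variable {G : Type*} [Group G]

theorem conjugatesOf_eq_of_mem {g c : G} (hc : c ∈ conjugatesOf g) :
    conjugatesOf c = conjugatesOf g :=
  (IsConj.conjugatesOf_eq (show IsConj g c from hc)).symm

theorem conj_mem_conjugatesOf {g c : G} (hc : c ∈ conjugatesOf g) (t : G) :
    t * c * t⁻¹ ∈ conjugatesOf g := by
  rw [← conjugatesOf_eq_of_mem hc]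
  exact (mem_conjugatesOf_iff_exists _ _).2 ⟨t, rfl⟩

theorem commutatorElement_mul_mul_of_central {a b z w : G} (hz : ∀ y, y * z = z * y)
    (hw : ∀ y, y * w = w * y) : ⁅a * z, b * w⁆ = ⁅a, b⁆ := by
  calc (a * z) * (b * w) * (a * z)⁻¹ * (b * w)⁻¹
      = a * (z * (b * w)) * z⁻¹ * a⁻¹ * w⁻¹ * b⁻¹ := by group
    _ = a * b * (w * a⁻¹) * w⁻¹ * b⁻¹ := by rw [← hz]; group
    _ = a * b * a⁻¹ * b⁻¹ := by rw [← hw]; group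

/-- The normal closure of an element with finite conjugacy class has finite commutator subgroup. -/
theorem finite_commutator_normalClosure {g : G} (hg : (conjugatesOf g).Finite) :
    Finite (commutator (Subgroup.closure (conjugatesOf g))) := by
  set N := Subgroup.closure (conjugatesOf g) with hN
  have : Finite (conjugatesOf g) := hg
  have hfin : ∀ c : conjugatesOf g, (Subgroup.centralizer {(c : G)}).FiniteIndex := fun c => by
    rw [finiteIndex_centralizer_iff, conjugatesOf_eq_of_mem c.2]
    exact hg
  have hinf : (⨅ c : conjugatesOf g, Subgroup.centralizer {(c : G)}).FiniteIndex :=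
    Subgroup.finiteIndex_iInf hfin
  -- Centralizing the finitely many generators means centralizing N, so the centre of N has finite
  -- index.
  have hle : (⨅ c : conjugatesOf g, Subgroup.centralizer {(c : G)}).subgroupOf N ≤
      Subgroup.center N := by
    intro x hx
    rw [Subgroup.mem_subgroupOf, Subgroup.mem_iInf] at hx
    have hx' : (x : G) ∈ Subgroup.centralizer (N : Set G) := by
      have h : Subgroup.centralizer (N : Set G) = Subgroup.centralizer (conjugatesOf g) := by
        rw [hN, Subgroup.centralizer_closure]
      rw [h, Subgroup.mem_centralizer_iff]
      exact fun c hc => (Subgroup.mem_centralizer_singleton_iff.1 (hx ⟨c, hc⟩)).symm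
    rw [Subgroup.mem_center_iff]
    exact fun y => Subtype.ext (Subgroup.mem_centralizer_iff.1 hx' y y.2)
  have : (Subgroup.center N).FiniteIndex := Subgroup.finiteIndex_of_le hle
  have : Finite (commutatorSet N) := by
    -- A commutator depends only on the classes of its entries modulo the centre, so there are
    -- finitely many commutators; Schur's theorem, found as an instance, then concludes.
    refine ((Set.finite_range fun ab : (N ⧸ Subgroup.center N) × (N ⧸ Subgroup.center N) =>
      ⁅ab.1.out, ab.2.out⁆).subset ?_).to_subtype
    rintro _ ⟨a, b, rfl⟩
    obtain ⟨z, hz⟩ := QuotientGroup.mk_out_eq_mul (Subgroup.center N) a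
    obtain ⟨w, hw⟩ := QuotientGroup.mk_out_eq_mul (Subgroup.center N) b
    refine ⟨(a, b), ?_⟩
    have hz' := fun y => Subgroup.mem_center_iff.1 z.2 y
    have hw' := fun y => Subgroup.mem_center_iff.1 w.2 y
    dsimp only
    rw [hz, hw]
    exact commutatorElement_mul_mul_of_central hz' hw'
  infer_instance

/-- A finitely generated abelian torsion group is finite. -/
theorem finite_closure_of_commute {s : Set G} (hs : s.Finite)
    (hcomm : ∀ x ∈ s, ∀ y ∈ s, x * y = y * x) (hord : ∀ x ∈ s, IsOfFinOrder x) :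
    Finite (Subgroup.closure s) := by
  have hc := Subgroup.isMulCommutative_closure hcomm
  let _ : CommGroup (Subgroup.closure s) := { mul_comm := fun x y => hc.is_comm.comm x y }
  have : Group.FG (Subgroup.closure s) :=
    (Group.fg_iff_subgroup_fg _).2 ((Subgroup.fg_iff _).2 ⟨s, rfl, hs⟩)
  refine CommGroup.finite_of_fg_isMulTorsion _ fun x => ?_
  suffices h : IsOfFinOrder (x : G) from
    (Subgroup.subtype_injective (Subgroup.closure s)).isOfFinOrder_iff.1 h
  obtain ⟨x, hx⟩ := x
  induction hx using Subgroup.closure_induction with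
  | mem x hx => exact hord x hx
  | one => exact IsOfFinOrder.one
  | mul x y hx hy h1 h2 =>
    refine Commute.isOfFinOrder_mul ?_ h1 h2
    exact congrArg Subtype.val
      (mul_comm (⟨x, hx⟩ : Subgroup.closure s) (⟨y, hy⟩ : Subgroup.closure s))
  | inv x _ h => exact h.inv

theorem normal_closure_conjugatesOf (g : G) : (Subgroup.closure (conjugatesOf g)).Normal := by
  have : conjugatesOf g = Group.conjugatesOfSet {g} := by
    simp [Group.conjugatesOfSet]
  rw [this]
  exact Subgroup.normalClosure_normal

/-- A group that is not ICC has a nontrivial finite normal subgroup, or an element of infinite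
order with finitely many, pairwise commuting conjugates. -/
theorem exists_of_not_isICC (hG : ¬ IsICC G) :
    (∃ N : Subgroup G, N.Normal ∧ Finite N ∧ N ≠ ⊥) ∨
      ∃ g : G, ¬ IsOfFinOrder g ∧ (conjugatesOf g).Finite ∧
        ∀ x ∈ conjugatesOf g, ∀ y ∈ conjugatesOf g, x * y = y * x := by
  simp only [IsICC, not_forall, Set.not_infinite] at hG
  obtain ⟨g, hg1, hg⟩ := hG
  set N := Subgroup.closure (conjugatesOf g) with hN
  have hnormal : N.Normal := normal_closure_conjugatesOf g
  have hgN : g ∈ N := Subgroup.subset_closure (mem_conjugatesOf_self)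
  by_cases hc : ⁅N, N⁆ = ⊥
  · have hcomm : ∀ x ∈ conjugatesOf g, ∀ y ∈ conjugatesOf g, x * y = y * x := by
      intro x hx y hy
      have h := Subgroup.commutator_mem_commutator
        (Subgroup.subset_closure hx : x ∈ N) (Subgroup.subset_closure hy : y ∈ N)
      rw [hc, Subgroup.mem_bot] at h
      exact commutatorElement_eq_one_iff_mul_comm.1 h
    by_cases hord : IsOfFinOrder g
    · refine Or.inl ⟨N, hnormal, finite_closure_of_commute hg hcomm fun x hx => ?_, fun h => ?_⟩
      · obtain ⟨t, rfl⟩ := (mem_conjugatesOf_iff_exists _ _).1 hx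
        exact (MulAut.conj t).toMonoidHom.isOfFinOrder hord
      · rw [h, Subgroup.mem_bot] at hgN
        exact hg1 hgN
    · exact Or.inr ⟨g, hord, hg, hcomm⟩
  · refine Or.inl ⟨⁅N, N⁆, Subgroup.commutator_normal N N, ?_, hc⟩
    have := finite_commutator_normalClosure hg
    rw [← Subgroup.map_subtype_commutator]
    exact Set.Finite.to_subtype ((Set.toFinite (commutator N : Set N)).image N.subtype)

end FiniteClass

/-! ### Transfer from ℓ^1 -/

section EllOneLift

variable {G F : Type*} [NormedAddCommGroup F] [NormedSpace ℂ F] [CompleteSpace F]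

/-- The operator `ξ ↦ ∑ ξ(g) v(g)` from `ℓ^1(G)` given by a family of vectors in the unit ball. -/
noncomputable def ellOneLift (v : G → F) (hv : ∀ g, ‖v g‖ ≤ 1) : EllP 1 G →L[ℂ] F :=
  (lp.tsumCLM ℂ G F).comp (lp.mapCLM 1 (fun g => ContinuousLinearMap.toSpanSingleton ℂ (v g))
    zero_le_one (fun g => (ContinuousLinearMap.norm_toSpanSingleton (𝕜 := ℂ) (v g)).trans_le (hv g)))

theorem ellOneLift_apply (v : G → F) (hv : ∀ g, ‖v g‖ ≤ 1) (ξ : EllP 1 G) :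
    ellOneLift v hv ξ = ∑' g, ξ g • v g := rfl

theorem ellOneLift_pointMass (v : G → F) (hv : ∀ g, ‖v g‖ ≤ 1) (g : G) :
    ellOneLift v hv (pointMass 1 g) = v g := by
  classical
  rw [ellOneLift_apply, tsum_eq_single g]
  · rw [pointMass_self, one_smul]
  · intro h hh
    rw [pointMass_apply, if_neg hh, zero_smul]

theorem ellOneLift_comp_rightRegular [Group G] (v : G → F) (hv : ∀ g, ‖v g‖ ≤ 1)
    {U : F →L[ℂ] F} {t : G} (h : ∀ g, v (g * t⁻¹) = U (v g)) :
    (ellOneLift v hv).comp (rightRegular 1 t) = U.comp (ellOneLift v hv) := by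
  refine clm_ext_pointMass ENNReal.one_ne_top fun g => ?_
  simp only [ContinuousLinearMap.comp_apply, rightRegular_pointMass, ellOneLift_pointMass, h]

variable {p : ℝ≥0∞} [Fact (1 ≤ p)]

theorem norm_pointMass_le (g : G) : ‖pointMass p g‖ ≤ 1 := by
  classical
  rw [pointMass, lp.norm_single (zero_lt_one.trans_le Fact.out), norm_one]

/-- The inclusion of `ℓ^1` into `ℓ^p`. -/
noncomputable def ellOneInclusion (p : ℝ≥0∞) [Fact (1 ≤ p)] (G : Type*) : EllP 1 G →L[ℂ] EllP p G :=
  ellOneLift (pointMass p) norm_pointMass_le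

theorem ellOneInclusion_apply (ξ : EllP 1 G) (g : G) : ellOneInclusion p G ξ g = ξ g := by
  have h : (evalCLM p g).comp (ellOneInclusion p G) = evalCLM 1 g := by
    classical
    refine clm_ext_pointMass ENNReal.one_ne_top fun k => ?_
    rw [ContinuousLinearMap.comp_apply, ellOneInclusion, ellOneLift_pointMass, evalCLM_apply,
      evalCLM_apply, pointMass_apply, pointMass_apply]
  exact congrArg (fun S : EllP 1 G →L[ℂ] ℂ => S ξ) h

/-- An operator on `ℓ^p` that comes from `ℓ^1` is nonzero if some functional on `ℓ^1` detects it. -/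
theorem ne_zero_of_intertwining [Group G] {X : EllP p G →L[ℂ] EllP p G}
    {Y : EllP 1 G →L[ℂ] EllP 1 G} {z : ℂ →L[ℂ] ℂ} {f : G → ℂ} (hf : ∀ g, ‖f g‖ ≤ 1)
    (hXY : (ellOneInclusion p G).comp Y = X.comp (ellOneInclusion p G))
    (hYz : (ellOneLift f hf).comp Y = z.comp (ellOneLift f hf)) (hf1 : f 1 = 1) (hz : z 1 ≠ 0) :
    X ≠ 0 := by
  rintro rfl
  -- The inclusion of ℓ^1 in ℓ^p is injective, so `X = 0` forces `Y δ_e = 0`, while the functional f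
  -- gives this vector the value `z 1`.
  have h1 : Y (pointMass 1 1) = 0 := by
    ext g
    have h := congrArg (fun S : EllP 1 G →L[ℂ] EllP p G => S (pointMass 1 1) g) hXY
    simpa [ellOneInclusion_apply] using h
  have h2 := congrArg (fun S : EllP 1 G →L[ℂ] ℂ => S (pointMass 1 1)) hYz
  simp only [ContinuousLinearMap.comp_apply, h1, map_zero, ellOneLift_pointMass, hf1] at h2
  exact hz h2.symm

end EllOneLift

/-! ### Functions of the right translations -/

section RightRegular

variable {p : ℝ≥0∞} [Fact (1 ≤ p)] {G : Type*} [Group G]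

instance nontrivial_ellP : Nontrivial (EllP p G) :=
  ⟨⟨deltaOne p G, 0, fun h => by
    have := congrArg (fun x : EllP p G => x 1) h
    simp [deltaOne_apply_one] at this⟩⟩

theorem norm_rightRegular_le (t : G) : ‖(rightRegular p t : EllP p G →L[ℂ] EllP p G)‖ ≤ 1 :=
  LinearMap.mkContinuous_norm_le _ zero_le_one _

theorem rightRegular_one : (rightRegular p (1 : G) : EllP p G →L[ℂ] EllP p G) = 1 := by
  ext x s
  change x (s * 1) = x s
  rw [mul_one]

theorem rightRegular_mul (s t : G) :
    (rightRegular p s * rightRegular p t : EllP p G →L[ℂ] EllP p G) = rightRegular p (s * t) := by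
  ext x k
  change x (k * s * t) = x (k * (s * t))
  rw [mul_assoc]

/-- `|cos| + c cos` applied to the isometry `ρ_p(h)`. -/
noncomputable def rhoCos (p : ℝ≥0∞) [Fact (1 ≤ p)] {G : Type*} [Group G] (c : ℂ) (h : G) :
    EllP p G →L[ℂ] EllP p G :=
  absCosAdd c (rightRegular p h) (rightRegular p h⁻¹)

theorem rhoCos_mul_rhoCos (h : G) : rhoCos p 1 h * rhoCos p (-1) h = 0 := by
  refine absCosAdd_mul_absCosAdd_neg (norm_rightRegular_le _) (norm_rightRegular_le _) ?_ ?_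
  · rw [rightRegular_mul, mul_inv_cancel, rightRegular_one]
  · rw [rightRegular_mul, inv_mul_cancel, rightRegular_one]

/-- Operators intertwining `ρ_p(h)^{±1}` with contractions `U`, `V` intertwine the functions of
these operators. -/
theorem comp_rhoCos {F : Type*} [NormedAddCommGroup F] [NormedSpace ℂ F] [CompleteSpace F]
    [Nontrivial F] (c : ℂ) {h : G} {J : EllP p G →L[ℂ] F} {U V : F →L[ℂ] F} (hU : ‖U‖ ≤ 1)
    (hV : ‖V‖ ≤ 1) (hJU : J.comp (rightRegular p h) = U.comp J)
    (hJV : J.comp (rightRegular p h⁻¹) = V.comp J) :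
    J.comp (rhoCos p c h) = (absCosAdd c U V).comp J :=
  comp_absCosAdd c (norm_rightRegular_le _) (norm_rightRegular_le _) hU hV hJU hJV

/-- The common source of the commutation rules below: J is in turn a translation ρ(t), an element of
CV_p(G), another `rhoCos`, and the inclusion of ℓ^1. -/
theorem comp_rhoCos_of_forall {q : ℝ≥0∞} [Fact (1 ≤ q)] (c : ℂ) {h k : G}
    {J : EllP p G →L[ℂ] EllP q G} (hJ : J.comp (rightRegular p h) = (rightRegular q k).comp J)
    (hJ' : J.comp (rightRegular p h⁻¹) = (rightRegular q k⁻¹).comp J) :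
    J.comp (rhoCos p c h) = (rhoCos q c k).comp J :=
  comp_rhoCos c (norm_rightRegular_le _) (norm_rightRegular_le _) hJ hJ'

theorem rightRegular_mul_rhoCos (c : ℂ) (t h : G) :
    rightRegular p t * rhoCos p c h = rhoCos p c (t * h * t⁻¹) * rightRegular p t := by
  have e : ∀ a b c d : G, a * b = c * d → (rightRegular p a).comp (rightRegular p b) =
      (rightRegular p c).comp (rightRegular p d) := fun a b c d h =>
    (rightRegular_mul a b).trans (h ▸ (rightRegular_mul c d).symm)
  exact comp_rhoCos_of_forall c (e _ _ _ _ (by group)) (e _ _ _ _ (by group))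

theorem mul_rhoCos_of_mem_CV {T : EllP p G →L[ℂ] EllP p G} (hT : T ∈ CV p G) (c : ℂ) (h : G) :
    T * rhoCos p c h = rhoCos p c h * T :=
  comp_rhoCos_of_forall c ((mem_CV_iff T).1 hT h).symm ((mem_CV_iff T).1 hT h⁻¹).symm

theorem commute_rhoCos (c d : ℂ) {h k : G} (hhk : h * k = k * h) :
    Commute (rhoCos p c h) (rhoCos p d k) := by
  have h1 : ∀ t : G, t * h = h * t → Commute (rhoCos p c h) (rightRegular p t) := by
    intro t ht
    have := rightRegular_mul_rhoCos (p := p) c t h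
    rw [ht, mul_inv_cancel_right] at this
    exact this.symm
  refine comp_rhoCos_of_forall d (h1 k hhk.symm) (h1 k⁻¹ ?_)
  rw [inv_mul_eq_iff_eq_mul, ← mul_assoc, ← hhk, mul_inv_cancel_right]

theorem ellOneInclusion_comp_rhoCos (c : ℂ) (h : G) :
    (ellOneInclusion p G).comp (rhoCos 1 c h) = (rhoCos p c h).comp (ellOneInclusion p G) :=
  comp_rhoCos_of_forall c
    (ellOneLift_comp_rightRegular _ _ fun g => (rightRegular_pointMass h g).symm)
    (ellOneLift_comp_rightRegular _ _ fun g => (rightRegular_pointMass h⁻¹ g).symm)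

/-- The character g^n ↦ (-1)^n, well defined because g has infinite order, extended by zero off the
cyclic subgroup. -/
theorem exists_alternating {g : G} (hg : ¬ IsOfFinOrder g) :
    ∃ f : G → ℂ, f 1 = 1 ∧ (∀ k, ‖f k‖ ≤ 1) ∧ ∀ k, f (k * g) = -f k := by
  classical
  have hinj : Function.Injective fun n : ℤ => g ^ n := injective_zpow_iff_not_isOfFinOrder.2 hg
  let f : G → ℂ := fun k => if h : ∃ n : ℤ, g ^ n = k then (-1) ^ h.choose else 0
  have hf : ∀ n : ℤ, f (g ^ n) = (-1) ^ n := by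
    intro n
    have h : ∃ m : ℤ, g ^ m = g ^ n := ⟨n, rfl⟩
    simp only [f, dif_pos h]
    rw [hinj h.choose_spec]
  refine ⟨f, by simpa using hf 0, fun k => ?_, fun k => ?_⟩
  · simp only [f]
    split_ifs <;> simp
  · by_cases h : ∃ n : ℤ, g ^ n = k
    · obtain ⟨n, rfl⟩ := h
      rw [← zpow_add_one, hf, hf, zpow_add_one₀ (by norm_num)]
      ring
    · have h' : ¬ ∃ n : ℤ, g ^ n = k * g := fun ⟨n, hn⟩ =>
        h ⟨n - 1, by rw [zpow_sub_one, hn, mul_inv_cancel_right]⟩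
      simp only [f, dif_neg h, dif_neg h', neg_zero]

/-- The alternating function is an eigenfunctional of ρ(g) with eigenvalue -1, where |cos| - cos
equals 2. -/
theorem rhoCos_neg_one_ne_zero {g : G} (hg : ¬ IsOfFinOrder g) : rhoCos p (-1) g ≠ 0 := by
  obtain ⟨f, hf1, hf, hfg⟩ := exists_alternating hg
  have hfg' : ∀ k, f (k * g⁻¹) = -f k := fun k => by
    have := hfg (k * g⁻¹)
    rw [inv_mul_cancel_right] at this
    rw [this, neg_neg]
  have hn : ‖(-1 : ℂ →L[ℂ] ℂ)‖ ≤ 1 := by rw [norm_neg, norm_one]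
  refine ne_zero_of_intertwining hf (ellOneInclusion_comp_rhoCos (-1) g)
    (comp_rhoCos (-1) hn hn (ellOneLift_comp_rightRegular f hf fun k => ?_)
      (ellOneLift_comp_rightRegular f hf fun k => ?_)) hf1 ?_
  · simpa using hfg' k
  · simpa using hfg k
  · rw [absCosAdd_neg_one_neg_one]
    norm_num

/-- Summation over G is invariant under every ρ(h), so each factor |cos| + cos acts on it as 2. -/
theorem list_prod_rhoCos_ne_zero (l : List G) : (l.map (rhoCos p 1)).prod ≠ 0 := by
  refine ne_zero_of_intertwining (f := fun _ => 1) (fun _ => norm_one.le)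
    (comp_list_prod (ellOneInclusion_comp_rhoCos 1) l)
    (comp_list_prod (f' := fun _ => absCosAdd 1 1 1) (fun h => comp_rhoCos 1 norm_one.le norm_one.le
      (ellOneLift_comp_rightRegular _ _ fun k => rfl)
      (ellOneLift_comp_rightRegular _ _ fun k => rfl)) l) rfl ?_
  rw [absCosAdd_one_one, List.map_const', List.prod_replicate, smul_pow, one_pow]
  norm_num

end RightRegular

/-! ### Annihilator ideals when G is not ICC -/

section NotSimple

variable {p : ℝ≥0∞} [Fact (1 ≤ p)] {G : Type*} [Group G]

/-- The annihilator in `CV_p(G)` of an operator commuting with `CV_p(G)`. -/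
noncomputable def annihilatorIdeal (q : EllP p G →L[ℂ] EllP p G)
    (hq : ∀ T ∈ CV p G, T * q = q * T) : TwoSidedIdeal (CV p G) :=
  TwoSidedIdeal.mk' {T | (T : EllP p G →L[ℂ] EllP p G) * q = 0} (zero_mul q)
    (fun {S T} hS hT => by
      change ((S : EllP p G →L[ℂ] EllP p G) + T) * q = 0
      rw [add_mul]
      exact (congrArg₂ _ hS hT).trans (add_zero 0))
    (fun {S} hS => by
      change (-(S : EllP p G →L[ℂ] EllP p G)) * q = 0
      rw [neg_mul]
      exact (congrArg _ hS).trans neg_zero)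
    (fun {S T} hT => by
      change ((S : EllP p G →L[ℂ] EllP p G) * T) * q = 0
      rw [mul_assoc]
      exact (congrArg _ hT).trans (mul_zero _))
    (fun {S T} hS => by
      change ((S : EllP p G →L[ℂ] EllP p G) * T) * q = 0
      rw [mul_assoc, hq T T.2, ← mul_assoc]
      exact (congrArg (· * (T : EllP p G →L[ℂ] EllP p G)) hS).trans (zero_mul _))

theorem mem_annihilatorIdeal {q : EllP p G →L[ℂ] EllP p G} {hq : ∀ T ∈ CV p G, T * q = q * T}
    {T : CV p G} : T ∈ annihilatorIdeal q hq ↔ (T : EllP p G →L[ℂ] EllP p G) * q = 0 :=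
  TwoSidedIdeal.mem_mk' _ _ _ _ _ _ _

theorem isClosed_annihilatorIdeal (hp : p ≠ ∞) (q : EllP p G →L[ℂ] EllP p G)
    (hq : ∀ T ∈ CV p G, T * q = q * T) :
    IsClosed[cvWeakStar p G] (annihilatorIdeal q hq : Set (CV p G)) := by
  have h : (annihilatorIdeal q hq : Set (CV p G)) = ⋂ x : EllP p G, ⋂ g : G,
      (fun T : CV p G => (T : EllP p G →L[ℂ] EllP p G) (q x) g) ⁻¹' {0} := by
    ext T
    simp only [Set.mem_iInter, Set.mem_preimage, Set.mem_singleton_iff]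
    refine mem_annihilatorIdeal.trans ⟨fun h x g => ?_, fun h => ?_⟩
    · exact congrArg (fun S : EllP p G →L[ℂ] EllP p G => S x g) h
    · ext x g
      exact h x g
  rw [h]
  refine @isClosed_iInter _ _ (cvWeakStar p G) _ fun x =>
    @isClosed_iInter _ _ (cvWeakStar p G) _ fun g => ?_
  exact @IsClosed.preimage _ _ (cvWeakStar p G) _ _
    (continuous_of_mem_cvPredual (coeff_mem_cvPredual hp (q x) g)) _ isClosed_singleton

theorem not_isWeakStarSimple_of_mul_eq_zero (hp : p ≠ ∞) {a q : EllP p G →L[ℂ] EllP p G}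
    (ha : a ∈ CV p G) (ha0 : a ≠ 0) (hq : ∀ T ∈ CV p G, T * q = q * T) (hq0 : q ≠ 0)
    (haq : a * q = 0) : ¬ IsWeakStarSimple (CV p G) (cvWeakStar p G) := by
  intro hs
  rcases hs _ (isClosed_annihilatorIdeal hp q hq) with h | h
  · have h1 : (⟨a, ha⟩ : CV p G) ∈ annihilatorIdeal q hq := mem_annihilatorIdeal.2 haq
    rw [h] at h1
    exact ha0 (congrArg Subtype.val ((TwoSidedIdeal.mem_bot _).1 h1))
  · have h1 : (1 : CV p G) ∈ annihilatorIdeal q hq := by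
      rw [h]; trivial
    exact hq0 ((one_mul q).symm.trans (mem_annihilatorIdeal.1 h1))

theorem not_isWeakStarSimple_of_finite_normal (hp : p ≠ ∞) {N : Subgroup G} [N.Normal] [Finite N]
    (hN : N ≠ ⊥) : ¬ IsWeakStarSimple (CV p G) (cvWeakStar p G) := by
  classical
  have := Fintype.ofFinite N
  obtain ⟨n, hn⟩ := Subgroup.ne_bot_iff_exists_ne_one.1 hN
  have hn1 : (n : G) ≠ 1 := fun h => hn (Subtype.ext h)
  let a : EllP p G →L[ℂ] EllP p G := ∑ m : N, rightRegular p (m : G)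
  refine not_isWeakStarSimple_of_mul_eq_zero hp (a := a) (q := rightRegular p (n : G) - 1)
    ?_ ?_ ?_ ?_ ?_
  · refine (mem_CV_iff _).2 fun t => ?_
    simp only [a, Finset.mul_sum, Finset.sum_mul, rightRegular_mul]
    refine Fintype.sum_equiv (MulAut.conjNormal t).toEquiv _ _ fun m => ?_
    congr 1
    simp
  -- Only m = 1 contributes to the coefficient of `a δ_e` at the identity, which is therefore 1.
  · intro h
    have h1 := congrArg (fun S : EllP p G →L[ℂ] EllP p G => evalCLM p 1 (S (pointMass p 1))) h
    simp only [a, sum_apply, map_sum, rightRegular_pointMass, evalCLM_apply,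
      pointMass_apply, one_mul] at h1
    simp at h1
  · intro T hT
    rw [mul_sub, sub_mul, (mem_CV_iff T).1 hT, mul_one, one_mul]
  · intro h
    have h1 := congrArg (fun S : EllP p G →L[ℂ] EllP p G => evalCLM p 1 (S (pointMass p 1))) h
    simp only [sub_apply, map_sub, rightRegular_pointMass, evalCLM_apply,
      pointMass_apply, one_mul] at h1
    simp [pointMass_apply, hn1] at h1
  · rw [mul_sub, mul_one, sub_eq_zero]
    simp only [a, Finset.sum_mul, rightRegular_mul]
    exact Fintype.sum_equiv (Equiv.mulRight n) _ _ fun m => rfl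

theorem not_isWeakStarSimple_of_infinite_order (hp : p ≠ ∞) {g : G} (hg : ¬ IsOfFinOrder g)
    (hfin : (conjugatesOf g).Finite)
    (hcomm : ∀ x ∈ conjugatesOf g, ∀ y ∈ conjugatesOf g, x * y = y * x) :
    ¬ IsWeakStarSimple (CV p G) (cvWeakStar p G) := by
  classical
  set l : List G := hfin.toFinset.toList with hl
  have hmem : ∀ x, x ∈ l ↔ x ∈ conjugatesOf g := by simp [hl]
  have hnd : l.Nodup := Finset.nodup_toList _
  have hpw : (l.map (rhoCos p 1)).Pairwise Commute := by
    refine List.pairwise_map.2 (List.Pairwise.imp_of_mem (R := fun _ _ => True) ?_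
      (List.pairwise_of_forall (fun _ _ => trivial)))
    intro x y hx hy _
    exact commute_rhoCos 1 1 (hcomm x ((hmem x).1 hx) y ((hmem y).1 hy))
  refine not_isWeakStarSimple_of_mul_eq_zero hp (a := (l.map (rhoCos p 1)).prod)
    (q := rhoCos p (-1) g) ?_ (list_prod_rhoCos_ne_zero l)
    (fun T hT => mul_rhoCos_of_mem_CV hT _ _) (rhoCos_neg_one_ne_zero hg) ?_
  -- Conjugation by t permutes the class of g, and the factors commute, so the product is unchanged.
  · refine (mem_CV_iff _).2 fun t => ?_
    have h1 : rightRegular p t * (l.map (rhoCos p 1)).prod =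
        (l.map fun h => rhoCos p 1 (t * h * t⁻¹)).prod * rightRegular p t :=
      comp_list_prod (fun h => rightRegular_mul_rhoCos 1 t h) l
    have hperm : (l.map fun h => t * h * t⁻¹).Perm l := by
      refine (List.perm_ext_iff_of_nodup (hnd.map ?_) hnd).2 fun x => ?_
      · intro x y hxy
        exact mul_left_cancel (mul_right_cancel hxy)
      · rw [List.mem_map, hmem]
        constructor
        · rintro ⟨y, hy, rfl⟩
          exact conj_mem_conjugatesOf ((hmem y).1 hy) t
        · intro hx
          refine ⟨t⁻¹ * x * t, (hmem _).2 ?_, by group⟩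
          simpa using conj_mem_conjugatesOf hx t⁻¹
    have h2 := (hperm.symm.map (rhoCos p 1)).prod_eq' hpw
    rw [List.map_map] at h2
    exact h1.trans (congrArg (· * rightRegular p t) h2.symm)
  · have hgl : g ∈ l := (hmem g).2 mem_conjugatesOf_self
    -- Moves the factor at g to the end, next to q, which it annihilates.
    have hperm : l.Perm (l.erase g ++ [g]) :=
      (List.perm_cons_erase hgl).trans (List.perm_append_singleton g _).symm
    rw [(hperm.map (rhoCos p 1)).prod_eq' hpw, List.map_append, List.prod_append, mul_assoc]
    simp [rhoCos_mul_rhoCos]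

end NotSimple

theorem theorem1p1 (G : Type*) [Group G] (p : ℝ≥0∞) [Fact (1 ≤ p)] (hp : p ≠ ∞) :
    IsWeakStarSimple (CV p G) (cvWeakStar p G) ↔ IsICC G := by
  refine ⟨fun hs => ?_, isWeakStarSimple_of_isICC hp⟩
  by_contra hG
  rcases exists_of_not_isICC hG with ⟨N, hN, hfin, hne⟩ | ⟨g, hg, hfin, hcomm⟩
  · exact not_isWeakStarSimple_of_finite_normal hp hne hs
  · exact not_isWeakStarSimple_of_infinite_order hp hg hfin hcomm hs
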